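/- Let $\mathbb F=\mathbb R$ or $\mathbb C$, let $K$ be a compact Hausdorff space and let $X$ be a uniformly convex Banach space over $\mathbb F$. A uniform algebra on $K$ is a (sup-norm) closed subalgebra of $C(K)=C(K,\mathbb F)$ that separates the points of $K$ and contains the constants. Let $A(K,X)$ be a function space over the base algebra $A$, that is, a linear subspace of $C(K,X)$ (with the supremum norm) such that (i) $A=\{x^*\circ f : x^*\in X^*,\ f\in A(K,X)\}$ is a uniform algebra on $K$; (ii) $g\otimes x\in A(K,X)$ for all $g\in A$, $x\in X$, where $(g\otimes x)(t)=g(t)x$; (iii) $g\cdot f\in A(K,X)$ for all $g\in A$, $f\in A(K,X)$. A set $L\subset K$ is a boundary for $A$ if for every $f\in A$ there is $t\in L$ with $|f(t)|=\|f\|_\infty$. Let $\Gamma$ be the Shilov boundary of $A$ (the smallest closed boundary), let $\Gamma'$ be the set of limit points of $\Gamma$, and let $\Gamma_0$ be the Choquet boundary of $A$, that is, the set of $t\in K$ for which the evaluation $f\mapsto f(t)$ is an extreme point of $K_A=\{\lambda\in A^*:\|\lambda\|=\lambda(1)=1\}$. For a normed space $E$ with closed unit ball $B_E$, a vector $x$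 with $\|x\|=1$ is a $\Delta$-point if $x\in\overline{\mathrm{conv}}\{y\in B_E:\|x-y\|\ge 2-\varepsilon\}$ for every $\varepsilon>0$, and $E$ has the convex diametral local diameter two property (convex-DLD2P) if the closed convex hull of the set of all $\Delta$-points of $E$ is $B_E$. Theorem. If $\Gamma'\cap\Gamma_0\neq\emptyset$, then $A(K,X)$ has the convex-DLD2P. -/

import Mathlib

/-- The points `y` of the unit ball with `‖x - y‖ ≥ 2 - ε`. -/
def deltaSet {E : Type*} [NormedAddCommGroup E] (x : E) (ε : ℝ) : Set E :=
  {y | ‖y‖ ≤ 1 ∧ 2 - ε ≤ ‖x - y‖}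

/-- `x` is a `Δ`-point: a unit vector with `x ∈ closure (conv (Δ_ε(x)))` for all `ε > 0`. -/
def IsDeltaPoint {E : Type*} [NormedAddCommGroup E] [NormedSpace ℝ E] (x : E) : Prop :=
  ‖x‖ = 1 ∧ ∀ ε : ℝ, 0 < ε → x ∈ closure (convexHull ℝ (deltaSet x ε))

/-- The convex diametral local diameter two property: the closed convex hull of the set of
`Δ`-points is the closed unit ball. Only the real-linear structure of `E` is involved. -/
def ConvexDLD2P (E : Type*) [NormedAddCommGroup E] [NormedSpace ℝ E] : Prop :=
  closure (convexHull ℝ {x : E | IsDeltaPoint x}) = Metric.closedBall (0 : E) 1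

/-- A uniform algebra on `K`: a closed subalgebra of `C(K, 𝕜)` that separates points.
A `Subalgebra` contains the constant functions. -/
structure IsUniformAlgebra {𝕜 K : Type*} [RCLike 𝕜] [TopologicalSpace K] [CompactSpace K]
    (A : Subalgebra 𝕜 C(K, 𝕜)) : Prop where
  isClosed : IsClosed (A : Set C(K, 𝕜))
  separatesPoints : A.SeparatesPoints

/-- `M ⊆ C(K, X)` is a function space `A(K, X)` over the base algebra `A`. -/
structure IsFunctionSpaceOver {𝕜 K X : Type*} [RCLike 𝕜] [TopologicalSpace K] [CompactSpace K]
    [NormedAddCommGroup X] [NormedSpace 𝕜 X]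
    (M : Submodule 𝕜 C(K, X)) (A : Subalgebra 𝕜 C(K, 𝕜)) : Prop where
  /-- The base algebra is the set of all `x* ∘ f` with `x* ∈ X*` and `f ∈ A(K, X)`. -/
  coe_base : (A : Set C(K, 𝕜)) =
    {g | ∃ φ : StrongDual 𝕜 X, ∃ f ∈ M, ∀ t, g t = φ (f t)}
  isUniformAlgebra : IsUniformAlgebra A
  /-- `A ⊗ X ⊆ A(K, X)`. -/
  tensor_mem : ∀ g ∈ A, ∀ x : X, g • ContinuousMap.const K x ∈ M
  smul_mem : ∀ g ∈ A, ∀ f ∈ M, g • f ∈ M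

/-- `L` is a boundary for `A`: every element of `A` attains its norm on `L`. -/
def IsAlgBoundary {𝕜 K : Type*} [RCLike 𝕜] [TopologicalSpace K] [CompactSpace K]
    (A : Subalgebra 𝕜 C(K, 𝕜)) (L : Set K) : Prop :=
  ∀ f ∈ A, ∃ t ∈ L, ‖f t‖ = ‖f‖

/-- The Shilov boundary of `A`: the smallest closed boundary, i.e. the intersection of all
closed boundaries. -/
def shilovBoundary {𝕜 K : Type*} [RCLike 𝕜] [TopologicalSpace K] [CompactSpace K]
    (A : Subalgebra 𝕜 C(K, 𝕜)) : Set K :=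
  ⋂₀ {L : Set K | IsClosed L ∧ IsAlgBoundary A L}

/-- The set `K_A` of functionals `ψ ∈ A*` with `‖ψ‖ = ψ(1) = 1`. -/
def stateSet {𝕜 K : Type*} [RCLike 𝕜] [TopologicalSpace K] [CompactSpace K]
    (A : Subalgebra 𝕜 C(K, 𝕜)) : Set (StrongDual 𝕜 A) :=
  {ψ | ‖ψ‖ = 1 ∧ ψ 1 = 1}

/-- The Choquet boundary of `A`: the points of `K` at which the evaluation functional is an
extreme point of `K_A`. -/
def choquetBoundary {𝕜 K : Type*} [RCLike 𝕜] [TopologicalSpace K] [CompactSpace K]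
    (A : Subalgebra 𝕜 C(K, 𝕜)) : Set K :=
  {t | ∃ ψ ∈ (stateSet A).extremePoints ℝ, ∀ f : A, ψ f = (f : C(K, 𝕜)) t}

/-! Reflecting `f` on a small open set where `‖f‖` is nearly one produces an element at distance
almost 2 that changes `f` only there. If `‖f‖ = 1` is attained at a limit point of the Shilov
boundary, there are arbitrarily many disjoint such sets; the average of the reflections is close to
`f`, so `f` is a `Δ`-point (`IsFunctionSpaceOver.isDeltaPoint`). For `f` in the unit ball and `t₀`
in `Γ' ∩ Γ₀`, write `f(t₀) = a v` with `v` a unit vector. Replacing `f` near `t₀` by `v`, or by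
`-v`, yields two such `Δ`-points, and their combination with weights `(1 ± a)/2` approximates `f`.
Both surgeries use `(1 - ε)(1 - Φ) f + Φ x`, of norm at most 1 when `Φ` takes values in the Stolz
region `|Φ| + (1 - ε)|1 - Φ| ≤ 1`. `IsApproxPeakSet.exists_stolz` builds such `Φ` from crude peak
functions bounded by 2. At Choquet points these are exponentials, obtained from uniqueness of the
representing functional and Hahn–Banach; near Shilov points they are powers of `(1 + f)/2`. -/

/-! ### Positive functionals representing Choquet points. -/

/-- The real part, as a continuous real-linear map `C(K, 𝕜) → C(K, ℝ)`. -/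
noncomputable def reCompCLM (𝕜 K : Type*) [RCLike 𝕜] [TopologicalSpace K] [CompactSpace K] :
    C(K, 𝕜) →L[ℝ] C(K, ℝ) :=
  (RCLike.reCLM : 𝕜 →L[ℝ] ℝ).compLeftContinuous ℝ K

@[simp]
theorem reCompCLM_apply {𝕜 K : Type*} [RCLike 𝕜] [TopologicalSpace K] [CompactSpace K]
    (f : C(K, 𝕜)) (t : K) : reCompCLM 𝕜 K f t = RCLike.re (f t) := rfl

theorem RCLike.eq_of_re_eq_of_re_I_mul_eq {𝕜 : Type*} [RCLike 𝕜] {z w : 𝕜}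
    (h : RCLike.re z = RCLike.re w)
    (hI : RCLike.re (RCLike.I * z) = RCLike.re (RCLike.I * w)) : z = w := by
  rw [RCLike.I_mul_re, RCLike.I_mul_re] at hI
  exact RCLike.ext h (neg_injective hI)

/-- A positive functional on `C(K, ℝ)` is bounded by its value at a majorant. -/
theorem abs_map_le_map_of_abs_le {K : Type*} [TopologicalSpace K] [CompactSpace K]
    {ℓ : StrongDual ℝ C(K, ℝ)} (hpos : ∀ u : C(K, ℝ), (∀ t, 0 ≤ u t) → 0 ≤ ℓ u)
    {u v : C(K, ℝ)} (h : ∀ t, |u t| ≤ v t) : |ℓ u| ≤ ℓ v := by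
  rw [abs_le]
  constructor
  · have := hpos (v + u) fun t => by
      have := neg_le_of_abs_le (h t)
      simp only [ContinuousMap.add_apply]; linarith
    rw [map_add] at this; linarith
  · have := hpos (v - u) fun t => by
      have := le_of_abs_le (h t)
      simp only [ContinuousMap.sub_apply]; linarith
    rw [map_sub] at this; linarith

/-- A density `k ≥ 0` with `ℓ k = 1` with respect to a positive functional `ℓ` on `C(K, ℝ)`
induces a state of `A`. -/
theorem exists_mem_stateSet_re_eq {𝕜 K : Type*} [RCLike 𝕜] [TopologicalSpace K]
    [CompactSpace K] (A : Subalgebra 𝕜 C(K, 𝕜)) {ℓ : StrongDual ℝ C(K, ℝ)}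
    (hpos : ∀ u : C(K, ℝ), (∀ t, 0 ≤ u t) → 0 ≤ ℓ u) {k : C(K, ℝ)} (hk : ∀ t, 0 ≤ k t)
    (hk1 : ℓ k = 1) :
    ∃ ψ ∈ stateSet A, ∀ f : A, RCLike.re (ψ f) = ℓ (k * reCompCLM 𝕜 K f) := by
  let fr : StrongDual ℝ C(K, 𝕜) :=
    ℓ.comp ((ContinuousLinearMap.mul ℝ C(K, ℝ) k).comp (reCompCLM 𝕜 K))
  have hfr : ∀ f, fr f = ℓ (k * reCompCLM 𝕜 K f) := fun f => rfl
  have hfrn : ‖fr‖ ≤ 1 := by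
    refine ContinuousLinearMap.opNorm_le_bound _ zero_le_one fun f => ?_
    have h1 : |ℓ (k * reCompCLM 𝕜 K f)| ≤ ℓ (‖f‖ • k) := by
      refine abs_map_le_map_of_abs_le hpos fun t => ?_
      simp only [ContinuousMap.mul_apply, reCompCLM_apply, ContinuousMap.smul_apply,
        smul_eq_mul, abs_mul, abs_of_nonneg (hk t)]
      rw [mul_comm]
      exact mul_le_mul_of_nonneg_right
        ((RCLike.abs_re_le_norm _).trans (f.norm_coe_le_norm t)) (hk t)
    rw [hfr, Real.norm_eq_abs, one_mul]
    simpa [hk1] using h1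
  let Ψ : StrongDual 𝕜 C(K, 𝕜) := fr.extendRCLike
  let ψ : StrongDual 𝕜 A := Ψ.comp A.toSubmodule.subtypeL
  have hψ : ∀ f : A, ψ f = Ψ f := fun f => rfl
  have hre : ∀ f : A, RCLike.re (ψ f) = ℓ (k * reCompCLM 𝕜 K f) := fun f => by
    rw [hψ, ← hfr]
    simp [Ψ]
  have hψle : ∀ f : A, ‖ψ f‖ ≤ ‖f‖ := fun f => by
    rw [hψ]
    refine (Ψ.le_opNorm _).trans ?_
    rw [StrongDual.norm_extendRCLike]
    exact mul_le_of_le_one_left (norm_nonneg _) hfrn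
  have hK : Nonempty K := by
    by_contra hK
    rw [not_nonempty_iff] at hK
    have : k = 0 := ContinuousMap.ext fun t => hK.elim t
    simp [this] at hk1
  have hn1 : ‖(1 : A)‖ = 1 := norm_one (α := C(K, 𝕜))
  have hre1 : RCLike.re (ψ 1) = 1 := by
    rw [hre, ← hk1]
    congr 1
    ext t
    simp
  have hψ1 : ψ 1 = 1 := by
    have h1 : ‖ψ 1‖ ≤ 1 := (hψle 1).trans_eq hn1
    have h2 : ‖ψ 1‖ = 1 := le_antisymm h1 (hre1 ▸ RCLike.re_le_norm _)
    rw [← hre1] at h1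
    rw [RCLike.norm_le_re_iff_eq_norm.mp h1, h2, RCLike.ofReal_one]
  refine ⟨ψ, ⟨le_antisymm ?_ ?_, hψ1⟩, hre⟩
  · exact ContinuousLinearMap.opNorm_le_bound _ zero_le_one fun f => by
      rw [one_mul]; exact hψle f
  · have := ψ.le_opNorm 1
    rwa [hψ1, hn1, norm_one, mul_one] at this

/-- A positive functional representing a point of the Choquet boundary acts multiplicatively
against real parts of elements of `A`: the case of a density with values in `[0, 1]`. -/
theorem map_mul_re_eq_of_mem_choquetBoundary_of_le_one {𝕜 K : Type*} [RCLike 𝕜]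
    [TopologicalSpace K] [CompactSpace K] {A : Subalgebra 𝕜 C(K, 𝕜)} {t₀ : K}
    (ht₀ : t₀ ∈ choquetBoundary A) {ℓ : StrongDual ℝ C(K, ℝ)}
    (hpos : ∀ u : C(K, ℝ), (∀ t, 0 ≤ u t) → 0 ≤ ℓ u)
    (hrep : ∀ g ∈ A, ℓ (reCompCLM 𝕜 K g) = RCLike.re (g t₀))
    {h : C(K, ℝ)} (h0 : ∀ t, 0 ≤ h t) (h1 : ∀ t, h t ≤ 1) {f : C(K, 𝕜)} (hf : f ∈ A) :
    ℓ (h * reCompCLM 𝕜 K f) = ℓ h * RCLike.re (f t₀) := by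
  have hone : ℓ 1 = 1 := by
    have := hrep 1 A.one_mem
    rw [ContinuousMap.one_apply, RCLike.one_re] at this
    rw [← this]
    congr 1
    ext t
    simp
  have hzero : ∀ k : C(K, ℝ), (∀ t, 0 ≤ k t) → ℓ k = 0 → ℓ (k * reCompCLM 𝕜 K f) = 0 := by
    intro k hk hk0
    have : |ℓ (k * reCompCLM 𝕜 K f)| ≤ ℓ (‖f‖ • k) := by
      refine abs_map_le_map_of_abs_le hpos fun t => ?_
      simp only [ContinuousMap.mul_apply, reCompCLM_apply, ContinuousMap.smul_apply,
        smul_eq_mul, abs_mul, abs_of_nonneg (hk t)]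
      rw [mul_comm]
      exact mul_le_mul_of_nonneg_right
        ((RCLike.abs_re_le_norm _).trans (f.norm_coe_le_norm t)) (hk t)
    rw [map_smul, hk0, smul_zero] at this
    exact abs_nonpos_iff.mp this
  have h0' : ∀ t, 0 ≤ (1 - h) t := fun t => by
    simpa using h1 t
  have hsub : ℓ (1 - h) = 1 - ℓ h := by rw [map_sub, hone]
  have ha0 : 0 ≤ ℓ h := hpos h h0
  have ha1 : 0 ≤ 1 - ℓ h := hsub ▸ hpos _ h0'
  rcases ha0.eq_or_lt with ha | ha
  · rw [hzero h h0 ha.symm, ← ha, zero_mul]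
  rcases ha1.eq_or_lt with hb | hb
  · have := hzero (1 - h) h0' (by rw [hsub, ← hb])
    rw [sub_mul, one_mul, map_sub, hrep f hf] at this
    have hlh : ℓ h = 1 := by linarith
    rw [hlh]; linarith
  -- The densities `h / ℓ h` and `(1 - h) / (1 - ℓ h)` split evaluation at `t₀` into a proper convex
  -- combination of two states; extremality makes the first of them evaluation itself.
  obtain ⟨ψ, hψ, hψe⟩ := ht₀
  obtain ⟨ψ₁, hψ₁, he₁⟩ := exists_mem_stateSet_re_eq A hpos (k := (ℓ h)⁻¹ • h)
    (fun t => mul_nonneg (inv_nonneg.2 ha.le) (h0 t))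
    (by rw [map_smul, smul_eq_mul, inv_mul_cancel₀ ha.ne'])
  obtain ⟨ψ₂, hψ₂, he₂⟩ := exists_mem_stateSet_re_eq A hpos (k := (1 - ℓ h)⁻¹ • (1 - h))
    (fun t => mul_nonneg (inv_nonneg.2 hb.le) (h0' t))
    (by rw [map_smul, smul_eq_mul, hsub, inv_mul_cancel₀ hb.ne'])
  have hre : ∀ g : A, RCLike.re ((ℓ h • ψ₁ + (1 - ℓ h) • ψ₂) g) = RCLike.re (ψ g) := by
    intro g
    rw [add_apply, smul_apply, smul_apply, map_add, RCLike.smul_re, RCLike.smul_re, he₁, he₂, hψe,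
      smul_mul_assoc, smul_mul_assoc, map_smul, map_smul, smul_eq_mul, smul_eq_mul,
      mul_inv_cancel_left₀ ha.ne', mul_inv_cancel_left₀ hb.ne', sub_mul, one_mul, map_sub,
      hrep _ g.2]
    ring
  have hcomb : ℓ h • ψ₁ + (1 - ℓ h) • ψ₂ = ψ := by
    ext g
    refine RCLike.eq_of_re_eq_of_re_I_mul_eq (hre g) ?_
    have := hre ((RCLike.I : 𝕜) • g)
    rwa [ContinuousLinearMap.map_smul, ContinuousLinearMap.map_smul, smul_eq_mul,
      smul_eq_mul] at this
  have h₁ := (mem_extremePoints.mp hψ).2 ψ₁ hψ₁ ψ₂ hψ₂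
    ⟨ℓ h, 1 - ℓ h, ha, hb, by ring, hcomb⟩
  have := he₁ ⟨f, hf⟩
  rw [h₁.1, hψe, smul_mul_assoc, map_smul, smul_eq_mul] at this
  rw [this, mul_inv_cancel_left₀ ha.ne']

/-- Both sides are linear in `h` and agree at `h = 1` by `hrep`, so an affine rescaling of `h` into
`[0, 1]` suffices. -/
theorem map_mul_re_eq_of_mem_choquetBoundary {𝕜 K : Type*} [RCLike 𝕜]
    [TopologicalSpace K] [CompactSpace K] {A : Subalgebra 𝕜 C(K, 𝕜)} {t₀ : K}
    (ht₀ : t₀ ∈ choquetBoundary A) {ℓ : StrongDual ℝ C(K, ℝ)}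
    (hpos : ∀ u : C(K, ℝ), (∀ t, 0 ≤ u t) → 0 ≤ ℓ u)
    (hrep : ∀ g ∈ A, ℓ (reCompCLM 𝕜 K g) = RCLike.re (g t₀))
    (h : C(K, ℝ)) {f : C(K, 𝕜)} (hf : f ∈ A) :
    ℓ (h * reCompCLM 𝕜 K f) = ℓ h * RCLike.re (f t₀) := by
  have hc : (0 : ℝ) < 2 * ‖h‖ + 1 := by positivity
  have key := map_mul_re_eq_of_mem_choquetBoundary_of_le_one ht₀ hpos hrep
    (h := (2 * ‖h‖ + 1)⁻¹ • (h + ‖h‖ • 1)) (fun t => by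
      have := neg_le_of_abs_le (h.norm_coe_le_norm t)
      simp only [ContinuousMap.smul_apply, ContinuousMap.add_apply, ContinuousMap.one_apply,
        smul_eq_mul, mul_one]
      exact mul_nonneg (inv_nonneg.2 hc.le) (by linarith)) (fun t => by
      have := le_of_abs_le (h.norm_coe_le_norm t)
      simp only [ContinuousMap.smul_apply, ContinuousMap.add_apply, ContinuousMap.one_apply,
        smul_eq_mul, mul_one]
      rw [inv_mul_le_iff₀ hc]
      linarith) hf
  have hone : ℓ 1 = 1 := by
    have := hrep 1 A.one_mem
    rw [ContinuousMap.one_apply, RCLike.one_re] at this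
    rw [← this]
    congr 1
    ext t
    simp
  simp only [smul_mul_assoc, add_mul, one_mul, map_smul, map_add, smul_eq_mul, hone, mul_one,
    hrep f hf] at key
  have := mul_left_cancel₀ (inv_pos.2 hc).ne' (key.trans (mul_assoc _ _ _))
  linarith

/-- A point of the Choquet boundary has a unique representing positive functional. -/
theorem map_eq_apply_of_mem_choquetBoundary {𝕜 K : Type*} [RCLike 𝕜]
    [TopologicalSpace K] [CompactSpace K] {A : Subalgebra 𝕜 C(K, 𝕜)}
    (hA : A.SeparatesPoints) {t₀ : K}
    (ht₀ : t₀ ∈ choquetBoundary A) {ℓ : StrongDual ℝ C(K, ℝ)}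
    (hpos : ∀ u : C(K, ℝ), (∀ t, 0 ≤ u t) → 0 ≤ ℓ u)
    (hrep : ∀ g ∈ A, ℓ (reCompCLM 𝕜 K g) = RCLike.re (g t₀)) (u : C(K, ℝ)) :
    ℓ u = u t₀ := by
  -- Quantifying over all `h` makes this set closed under products. It contains the real parts of
  -- `A`, which separate points, so it is everything by Stone–Weierstrass.
  let B : Subalgebra ℝ C(K, ℝ) :=
    { carrier := {v | ∀ h, ℓ (h * v) = ℓ h * v t₀}
      mul_mem' := fun {v w} hv hw h => by
        rw [← mul_assoc, hw, hv, ContinuousMap.mul_apply, mul_assoc]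
      add_mem' := fun {v w} hv hw h => by
        rw [mul_add, map_add, hv, hw, ContinuousMap.add_apply, mul_add]
      algebraMap_mem' := fun r h => by
        rw [Algebra.algebraMap_eq_smul_one, mul_smul_comm, mul_one, map_smul]
        simp [mul_comm] }
  have hBcl : IsClosed (B : Set C(K, ℝ)) := by
    have : (B : Set C(K, ℝ)) = ⋂ h : C(K, ℝ), {v | ℓ (h * v) = ℓ h * v t₀} := by
      ext v
      simp [B]
    rw [this]
    refine isClosed_iInter fun h => isClosed_eq ?_ ?_
    · exact ℓ.continuous.comp (continuous_const.mul continuous_id)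
    · exact continuous_const.mul (continuous_eval_const t₀)
  have hre : ∀ g ∈ A, reCompCLM 𝕜 K g ∈ B := fun g hg h =>
    map_mul_re_eq_of_mem_choquetBoundary ht₀ hpos hrep h hg
  have hsep : B.SeparatesPoints := by
    intro s t hst
    obtain ⟨_, ⟨g, hg, rfl⟩, hgst⟩ := hA hst
    by_cases hr : RCLike.re (g s) = RCLike.re (g t)
    · refine ⟨_, ⟨_, hre _ (A.smul_mem hg (RCLike.I : 𝕜)), rfl⟩, fun hI => hgst ?_⟩
      exact RCLike.eq_of_re_eq_of_re_I_mul_eq hr hI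
    · exact ⟨_, ⟨_, hre _ hg, rfl⟩, hr⟩
  have htop : u ∈ B := by
    refine Subalgebra.topologicalClosure_minimal le_rfl hBcl ?_
    rw [ContinuousMap.subalgebra_topologicalClosure_eq_top_of_separatesPoints B hsep]
    trivial
  have h1 := htop 1
  have hone : ℓ 1 = 1 := by
    have := hrep 1 A.one_mem
    rw [ContinuousMap.one_apply, RCLike.one_re] at this
    rw [← this]
    congr 1
    ext t
    simp
  rwa [one_mul, hone, one_mul] at h1

/-! ### Majorants and approximate peak functions at Choquet points. -/

/-- At a point `t₀` of the Choquet boundary, the value of a continuous real function is the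
infimum of the values of its majorants among the real parts of elements of `A`. -/
theorem exists_lt_re_of_mem_choquetBoundary {𝕜 K : Type*} [RCLike 𝕜]
    [TopologicalSpace K] [CompactSpace K] {A : Subalgebra 𝕜 C(K, 𝕜)}
    (hA : A.SeparatesPoints) {t₀ : K} (ht₀ : t₀ ∈ choquetBoundary A) {u : C(K, ℝ)}
    (hu : u t₀ = 0) {ε : ℝ} (hε : 0 < ε) :
    ∃ g ∈ A, (∀ t, u t < RCLike.re (g t)) ∧ RCLike.re (g t₀) < ε := by
  -- The uniform margin `η` makes `S` open, so a point outside it can be separated from it.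
  let S : Set C(K, ℝ) :=
    {v | ∃ g ∈ A, ∃ η : ℝ, 0 < η ∧ (∀ t, v t + η ≤ RCLike.re (g t)) ∧ RCLike.re (g t₀) < ε}
  suffices h : u ∈ S by
    obtain ⟨g, hg, η, hη, h1, h2⟩ := h
    exact ⟨g, hg, fun t => by linarith [h1 t], h2⟩
  by_contra huS
  have hopen : IsOpen S := by
    rw [Metric.isOpen_iff]
    rintro v ⟨g, hg, η, hη, h1, h2⟩
    refine ⟨η / 2, half_pos hη, fun w hw => ⟨g, hg, η / 2, half_pos hη, fun t => ?_, h2⟩⟩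
    have h3 := (ContinuousMap.dist_apply_le_dist t).trans_lt (Metric.mem_ball.mp hw)
    rw [Real.dist_eq] at h3
    linarith [h1 t, (abs_lt.mp h3).2]
  have hconv : Convex ℝ S := by
    rintro v ⟨g, hg, η, hη, h1, h2⟩ v' ⟨g', hg', η', hη', h1', h2'⟩ a b ha hb hab
    refine ⟨(a : 𝕜) • g + (b : 𝕜) • g', A.add_mem (A.smul_mem hg _) (A.smul_mem hg' _),
      a * η + b * η', ?_, fun t => ?_, ?_⟩
    · rcases ha.eq_or_lt with rfl | ha
      · rw [zero_add] at hab; simp [hab, hη']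
      · positivity
    · simp only [ContinuousMap.add_apply, ContinuousMap.smul_apply, smul_eq_mul, map_add,
        RCLike.re_ofReal_mul]
      nlinarith [mul_le_mul_of_nonneg_left (h1 t) ha, mul_le_mul_of_nonneg_left (h1' t) hb]
    · simp only [ContinuousMap.add_apply, ContinuousMap.smul_apply, smul_eq_mul, map_add,
        RCLike.re_ofReal_mul]
      have hb' : b = 1 - a := by linarith
      rcases ha.eq_or_lt with rfl | ha
      · simpa [hb'] using h2'
      · have h3 := mul_lt_mul_of_pos_left h2 ha
        have h4 := mul_le_mul_of_nonneg_left h2'.le hb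
        have h5 : a * ε + b * ε = ε := by rw [← add_mul, hab, one_mul]
        linarith
  obtain ⟨ℓ, hℓ⟩ := geometric_hahn_banach_open_point hconv hopen huS
  -- `ℓ` is bounded above on `S`, hence nonpositive along every ray in `S`. This yields positivity
  -- and, up to the factor `ℓ 1`, that `ℓ` represents `t₀`; then `ℓ u = ℓ 1 * u t₀ = 0`, against `0
  -- < ℓ u`.
  have hray : ∀ v : C(K, ℝ), (∀ c : ℝ, 0 < c → c • v ∈ S) → ℓ v ≤ 0 := by
    intro v hv
    by_contra! h
    have := hℓ _ (hv ((|ℓ u| + 1) / ℓ v) (by positivity))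
    rw [map_smul, smul_eq_mul, div_mul_cancel₀ _ h.ne'] at this
    linarith [le_abs_self (ℓ u)]
  have hmem : ∀ (v : C(K, ℝ)) (g : C(K, 𝕜)), g ∈ A → (∀ t, v t ≤ RCLike.re (g t)) →
      RCLike.re (g t₀) ≤ 0 → v ∈ S := by
    intro v g hg hv hg0
    refine ⟨g + ContinuousMap.const K ((ε / 2 : ℝ) : 𝕜),
      A.add_mem hg (A.algebraMap_mem _), ε / 2, half_pos hε, fun t => ?_, ?_⟩
    · simp only [ContinuousMap.add_apply, ContinuousMap.const_apply, map_add, RCLike.ofReal_re]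
      linarith [hv t]
    · simp only [ContinuousMap.add_apply, ContinuousMap.const_apply, map_add, RCLike.ofReal_re]
      linarith
  have hu0 : 0 < ℓ u := by
    simpa using hℓ 0 (hmem 0 0 A.zero_mem (by simp) (by simp))
  have hpos : ∀ v : C(K, ℝ), (∀ t, 0 ≤ v t) → 0 ≤ ℓ v := by
    intro v hv
    have := hray (-v) fun c hc => hmem _ 0 A.zero_mem (fun t => by
      simpa using mul_nonneg hc.le (hv t)) (by simp)
    rw [map_neg] at this
    linarith
  have hnonpos : ∀ g ∈ A, RCLike.re (g t₀) = 0 → ℓ (reCompCLM 𝕜 K g) ≤ 0 := by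
    intro g hg h0
    refine hray _ fun c hc => hmem _ ((c : 𝕜) • g) (A.smul_mem hg _) (fun t => ?_) ?_
    · simp [RCLike.smul_re]
    · simp [RCLike.smul_re, h0]
  have hzero : ∀ g ∈ A, RCLike.re (g t₀) = 0 → ℓ (reCompCLM 𝕜 K g) = 0 := by
    intro g hg h0
    refine le_antisymm (hnonpos g hg h0) ?_
    have := hnonpos (-g) (A.neg_mem hg) (by simp [h0])
    rw [map_neg, map_neg] at this
    linarith
  have hrep : ∀ g ∈ A, ℓ (reCompCLM 𝕜 K g) = ℓ 1 * RCLike.re (g t₀) := by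
    intro g hg
    have h1 := hzero (g - ContinuousMap.const K ((RCLike.re (g t₀) : ℝ) : 𝕜))
      (A.sub_mem hg (A.algebraMap_mem _)) (by simp)
    have h2 : reCompCLM 𝕜 K (ContinuousMap.const K ((RCLike.re (g t₀) : ℝ) : 𝕜)) =
        RCLike.re (g t₀) • (1 : C(K, ℝ)) := by
      ext t
      simp
    rw [map_sub, map_sub, h2, map_smul, smul_eq_mul] at h1
    linarith
  have hone : 0 < ℓ 1 := by
    refine (hpos 1 fun t => zero_le_one).lt_of_ne fun h => ?_
    have := abs_map_le_map_of_abs_le hpos (u := u) (v := ‖u‖ • 1) fun t => by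
      simpa using u.norm_coe_le_norm t
    rw [map_smul, ← h, smul_zero] at this
    linarith [le_abs_self (ℓ u)]
  have key := map_eq_apply_of_mem_choquetBoundary hA ht₀ (ℓ := (ℓ 1)⁻¹ • ℓ)
    (fun v hv => mul_nonneg (inv_nonneg.2 hone.le) (hpos v hv))
    (fun g hg => by
      rw [smul_apply, hrep g hg, smul_eq_mul, inv_mul_cancel_left₀ hone.ne']) u
  rw [hu, smul_apply, smul_eq_mul] at key
  exact (mul_pos (inv_pos.2 hone) hu0).ne' key

/-- Treats both fields at once through `|exp z|² = exp z · exp z̄ = exp (2 Re z)`. -/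
theorem RCLike.norm_exp {𝕜 : Type*} [RCLike 𝕜] (z : 𝕜) :
    ‖NormedSpace.exp z‖ = Real.exp (RCLike.re z) := by
  have h1 : (RCLike.re z : 𝕜) + (RCLike.re z : 𝕜) = z + star z := by
    rw [← two_mul]
    exact (RCLike.add_conj z).symm
  have h2 : ((Real.exp (RCLike.re z) : ℝ) : 𝕜) = NormedSpace.exp (RCLike.re z : 𝕜) := by
    rw [Real.exp_eq_exp_ℝ]
    exact NormedSpace.map_exp (algebraMap ℝ 𝕜) RCLike.continuous_ofReal _
  have h3 : ((‖NormedSpace.exp z‖ : ℝ) : 𝕜) ^ 2 = ((Real.exp (RCLike.re z) : ℝ) : 𝕜) ^ 2 := by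
    rw [h2, sq (NormedSpace.exp _), ← NormedSpace.exp_add, h1, NormedSpace.exp_add,
      ← NormedSpace.star_exp]
    exact (RCLike.mul_conj _).symm
  have h4 : ‖NormedSpace.exp z‖ ^ 2 = Real.exp (RCLike.re z) ^ 2 := by exact_mod_cast h3
  exact (sq_eq_sq₀ (norm_nonneg _) (Real.exp_pos _).le).mp h4

/-- A closed subalgebra of `C(K, 𝕜)` is stable under the exponential. -/
theorem exists_mem_forall_apply_eq_exp {𝕜 K : Type*} [RCLike 𝕜] [TopologicalSpace K]
    [CompactSpace K] {A : Subalgebra 𝕜 C(K, 𝕜)} (hA : IsClosed (A : Set C(K, 𝕜)))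
    {g : C(K, 𝕜)} (hg : g ∈ A) :
    ∃ φ ∈ A, ∀ t, φ t = NormedSpace.exp (g t) := by
  let _ : NormedAlgebra ℚ C(K, 𝕜) := NormedAlgebra.restrictScalars ℚ 𝕜 C(K, 𝕜)
  refine ⟨NormedSpace.exp g, ?_, fun t => ?_⟩
  · have h := NormedSpace.exp_series_hasSum_exp' (𝕂 := 𝕜) g
    refine hA.mem_of_tendsto h (Filter.Eventually.of_forall fun s => ?_)
    exact A.sum_mem fun n _ => A.smul_mem (A.pow_mem hg n) _
  · exact NormedSpace.map_exp (ContinuousMap.evalAlgHom 𝕜 𝕜 t) (continuous_eval_const t) g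

/-- Approximate peak functions at a point of the Choquet boundary. -/
theorem exists_approx_peak_of_mem_choquetBoundary {𝕜 K : Type*} [RCLike 𝕜]
    [TopologicalSpace K] [CompactSpace K] [T2Space K] {A : Subalgebra 𝕜 C(K, 𝕜)}
    (hA : IsUniformAlgebra A) {t₀ : K} (ht₀ : t₀ ∈ choquetBoundary A) {U : Set K}
    (hU : IsOpen U) (htU : t₀ ∈ U) {δ : ℝ} (hδ : 0 < δ) :
    ∃ φ ∈ A, φ t₀ = 1 ∧ (∀ t, ‖φ t‖ ≤ 2) ∧ ∀ t ∉ U, ‖φ t‖ ≤ δ := by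
  obtain ⟨h, h0, h1, hI⟩ := exists_continuous_zero_one_of_isClosed
    (isClosed_singleton (x := t₀)) hU.isClosed_compl
    (Set.disjoint_singleton_left.2 fun h => h htU)
  -- With `φ = exp (g t₀ - g)`, the height `N` off `U` makes `exp (-Re g) ≤ δ / 2` there, while `Re
  -- (g t₀) < log 2` costs at most a factor 2.
  let N : ℝ := |Real.log (2 / δ)|
  obtain ⟨g, hg, hg1, hg2⟩ := exists_lt_re_of_mem_choquetBoundary hA.separatesPoints ht₀
    (u := N • h) (by simp [h0 (Set.mem_singleton t₀)]) (Real.log_pos one_lt_two)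
  obtain ⟨φ, hφ, hφe⟩ := exists_mem_forall_apply_eq_exp hA.isClosed
    (g := ContinuousMap.const K (g t₀) - g) (A.sub_mem (A.algebraMap_mem (g t₀)) hg)
  have hval : ∀ t, ‖φ t‖ = Real.exp (RCLike.re (g t₀)) * Real.exp (-RCLike.re (g t)) := by
    intro t
    rw [hφe, RCLike.norm_exp, ← Real.exp_add]
    simp [sub_eq_add_neg]
  have he : Real.exp (RCLike.re (g t₀)) ≤ 2 := by
    rw [← Real.le_log_iff_exp_le two_pos]
    exact hg2.le
  refine ⟨φ, hφ, ?_, fun t => ?_, fun t ht => ?_⟩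
  · simp [hφe, NormedSpace.exp_zero]
  · have h2 : 0 ≤ RCLike.re (g t) :=
      (mul_nonneg (abs_nonneg _) (hI t).1).trans (hg1 t).le
    rw [hval]
    have h3 : Real.exp (-RCLike.re (g t)) ≤ 1 := Real.exp_le_one_iff.2 (by linarith)
    nlinarith [Real.exp_pos (RCLike.re (g t₀)), Real.exp_pos (-RCLike.re (g t))]
  · have h2 := hg1 t
    have h3 : h t = 1 := h1 ht
    rw [ContinuousMap.smul_apply, h3, smul_eq_mul, mul_one] at h2
    have h4 : Real.exp (-RCLike.re (g t)) ≤ δ / 2 := by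
      rw [← Real.le_log_iff_exp_le (by positivity), ← inv_div, Real.log_inv]
      linarith [le_abs_self (Real.log (2 / δ))]
    rw [hval]
    calc _ ≤ 2 * (δ / 2) := mul_le_mul he h4 (Real.exp_pos _).le zero_le_two
      _ = δ := by ring

/-! ### Peak functions with values in a Stolz region. -/

/-- `P` is an approximate peak set for `A`: elements of `A` that are bounded by `2` and equal to
`1` on `P` can be made uniformly small outside any neighbourhood of `P`. -/
def IsApproxPeakSet {𝕜 K : Type*} [RCLike 𝕜] [TopologicalSpace K] [CompactSpace K]
    (A : Subalgebra 𝕜 C(K, 𝕜)) (P : Set K) : Prop :=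
  ∀ U : Set K, IsOpen U → P ⊆ U → ∀ δ : ℝ, 0 < δ →
    ∃ φ ∈ A, (∀ t ∈ P, φ t = 1) ∧ (∀ t, ‖φ t‖ ≤ 2) ∧ ∀ t ∉ U, ‖φ t‖ ≤ δ

/-- Geometrically weighted sums of terms that are at first close to `1`, then bounded by `2` for
a single index, and then small, stay in a Stolz region. -/
theorem norm_add_mul_norm_le_one_of_geometric {E : Type*} [SeminormedAddCommGroup E]
    {r δ ε : ℝ} (hr0 : 0 ≤ r) (hr1 : r ≤ 1) (hδ : 0 ≤ δ) (hε : ε ≤ 1)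
    (h : 4 * δ + 5 * (1 - r) ≤ ε) {s p : ℕ → E} {U : ℕ → Prop} {x y : ℕ → ℝ}
    (hs : ∀ m, ‖s (m + 1)‖ ≤ ‖s m‖ + (1 - r) * r ^ m * y m)
    (hp : ∀ m, ‖p (m + 1)‖ ≤ ‖p m‖ + (1 - r) * r ^ m * x m)
    (hps : ∀ m, ‖p m‖ ≤ ‖s m‖ + (1 - r ^ m)) (hs0 : s 0 = 0)
    (hx : ∀ m, x m ≤ 2) (hy : ∀ m, y m ≤ 1 + x m)
    (hin : ∀ m, U m → ‖s m‖ ≤ δ * r ^ m) (hout : ∀ m, ¬ U m → x m ≤ δ) (m : ℕ) :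
    ‖p m‖ + (1 - ε) * ‖s m‖ ≤ 1 := by
  have hε0 : 0 ≤ 1 - ε := by linarith
  have hin' : ∀ m, U m → ‖p m‖ + (1 - ε) * ‖s m‖ ≤ 1 - (1 - 2 * δ) * r ^ m := by
    intro m hm
    have h1 := hin m hm
    have h2 : (1 - ε) * ‖s m‖ ≤ ‖s m‖ := mul_le_of_le_one_left (norm_nonneg _) (by linarith)
    linarith [hps m]
  have hstep : ∀ m, ‖p (m + 1)‖ + (1 - ε) * ‖s (m + 1)‖ ≤
      ‖p m‖ + (1 - ε) * ‖s m‖ + (1 - r) * r ^ m * (x m + (1 - ε) * (1 + x m)) := by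
    intro m
    have hw : 0 ≤ (1 - r) * r ^ m := mul_nonneg (by linarith) (pow_nonneg hr0 m)
    have h1 := mul_le_mul_of_nonneg_left (hs m) hε0
    have h2 := mul_le_mul_of_nonneg_left (mul_le_mul_of_nonneg_left (hy m) hw) hε0
    linarith [hp m]
  -- The deficit `(1 - ε + 2δ) r ^ m` is the total of all later increments while `x ≤ δ`, so it
  -- reproduces itself. On leaving `U` one increment may be as large as `5 (1 - r) r ^ m`; the
  -- hypothesis on `δ` and `r` absorbs exactly this.
  have hout' : ∀ m, ¬ U m → ‖p m‖ + (1 - ε) * ‖s m‖ ≤ 1 - (1 - ε + 2 * δ) * r ^ m := by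
    intro m
    induction m with
    | zero =>
      intro _
      have h1 := hps 0
      rw [hs0, norm_zero, pow_zero] at h1
      rw [hs0, norm_zero, pow_zero]
      linarith
    | succ m ih =>
      intro hm
      have hrm : 0 ≤ r ^ m := pow_nonneg hr0 m
      have hw : 0 ≤ (1 - r) * r ^ m := mul_nonneg (by linarith) hrm
      refine (hstep m).trans ?_
      by_cases hUm : U m
      · have h1 := hin' m hUm
        have h2 : x m + (1 - ε) * (1 + x m) ≤ 5 := by nlinarith [hx m]
        have h3 := mul_le_mul_of_nonneg_left h2 hw
        have h4 : (1 - ε + 2 * δ) * r ≤ 1 - 2 * δ - 5 * (1 - r) :=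
          (mul_le_of_le_one_right (by linarith) hr1).trans (by linarith)
        have h5 := mul_le_mul_of_nonneg_right h4 hrm
        rw [pow_succ]
        linarith
      · have h1 := ih hUm
        have h2 : x m + (1 - ε) * (1 + x m) ≤ 1 - ε + 2 * δ := by nlinarith [hout m hUm]
        have h3 := mul_le_mul_of_nonneg_left h2 hw
        rw [pow_succ]
        linarith
  have hrm : 0 ≤ r ^ m := pow_nonneg hr0 m
  by_cases hUm : U m
  · have := mul_nonneg (show 0 ≤ 1 - 2 * δ by linarith) hrm
    linarith [hin' m hUm]
  · have := mul_nonneg (show 0 ≤ 1 - ε + 2 * δ by linarith) hrm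
    linarith [hout' m hUm]

/-- Urysohn-type lemma: an approximate peak set admits peak functions with values in a Stolz
region that are small outside a given neighbourhood. -/
theorem IsApproxPeakSet.exists_stolz {𝕜 K : Type*} [RCLike 𝕜] [TopologicalSpace K]
    [CompactSpace K] {A : Subalgebra 𝕜 C(K, 𝕜)} (hA : IsClosed (A : Set C(K, 𝕜)))
    {P : Set K} (hP : IsApproxPeakSet A P) {V : Set K} (hV : IsOpen V) (hPV : P ⊆ V)
    {ε : ℝ} (hε : 0 < ε) (hε1 : ε ≤ 1) :
    ∃ Φ ∈ A, (∀ t ∈ P, Φ t = 1) ∧ (∀ t ∉ V, ‖Φ t‖ ≤ ε) ∧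
      ∀ t, ‖Φ t‖ + (1 - ε) * ‖1 - Φ t‖ ≤ 1 := by
  -- With `δ = ε / 8` and `1 - r = ε / 10`, both `4δ` and `5 (1 - r)` equal `ε / 2`.
  obtain ⟨δ, hδ⟩ : ∃ δ, δ = ε / 8 := ⟨_, rfl⟩
  obtain ⟨r, hr⟩ : ∃ r, r = 1 - ε / 10 := ⟨_, rfl⟩
  have hδ0 : 0 < δ := by rw [hδ]; positivity
  have hr0 : 0 < r := by linarith
  have hr1 : r < 1 := by linarith
  -- A state is a partial sum of `Φ - 1` together with a neighbourhood of `P`. The next peak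
  -- function is small off that neighbourhood, which is then shrunk to where the new sum is tiny.
  let σ := {p : C(K, 𝕜) × Set K // p.1 ∈ A ∧ (∀ t ∈ P, p.1 t = 0) ∧ IsOpen p.2 ∧ P ⊆ p.2}
  have hpk : ∀ q : σ, ∃ φ ∈ A, (∀ t ∈ P, φ t = 1) ∧ (∀ t, ‖φ t‖ ≤ 2) ∧
      ∀ t ∉ q.1.2, ‖φ t‖ ≤ δ := fun q => hP q.1.2 q.2.2.2.1 q.2.2.2.2 δ hδ0
  choose φ hφA hφP hφ2 hφδ using hpk
  let next : ℕ → σ → C(K, 𝕜) := fun n q => q.1.1 + (((1 - r) * r ^ n : ℝ) : 𝕜) • (φ q - 1)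
  have hnextP : ∀ n q, ∀ t ∈ P, next n q t = 0 := by
    intro n q t ht
    simp [next, q.2.2.1 t ht, hφP q t ht]
  let step : ℕ → σ → σ := fun n q =>
    ⟨(next n q, q.1.2 ∩ {t | ‖next n q t‖ < δ * r ^ (n + 1)}),
      A.add_mem q.2.1 (A.smul_mem (A.sub_mem (hφA q) A.one_mem) _),
      hnextP n q, q.2.2.2.1.inter (isOpen_lt (next n q).continuous.norm continuous_const),
      fun t ht => ⟨q.2.2.2.2 ht, by
        simp only [Set.mem_ofPred_eq, hnextP n q t ht, norm_zero]; positivity⟩⟩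
  let Q : ℕ → σ := fun n => Nat.rec ⟨(0, V), A.zero_mem, fun _ _ => rfl, hV, hPV⟩ step n
  let S : ℕ → C(K, 𝕜) := fun n => (Q n).1.1
  let U : ℕ → Set K := fun n => (Q n).1.2
  have hS : ∀ n, S (n + 1) = S n + (((1 - r) * r ^ n : ℝ) : 𝕜) • (φ (Q n) - 1) := fun _ => rfl
  have hUsub : ∀ n, U (n + 1) ⊆ U n := fun n => Set.inter_subset_left
  have hUV : ∀ n, U n ⊆ V := fun n => by
    induction n with
    | zero => exact subset_rfl
    | succ n ih => exact (hUsub n).trans ih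
  have hin : ∀ n, ∀ t ∈ U n, ‖S n t‖ ≤ δ * r ^ n := by
    rintro (_ | n) t ht
    · simp [S, Q, hδ0.le]
    · exact ht.2.le
  have hw : ∀ n, 0 ≤ (1 - r) * r ^ n := fun n => mul_nonneg (by linarith) (pow_nonneg hr0.le n)
  have hwn : ∀ n, ‖(((1 - r) * r ^ n : ℝ) : 𝕜)‖ = (1 - r) * r ^ n := fun n => by
    rw [RCLike.norm_ofReal, abs_of_nonneg (hw n)]
  have hφ1 : ∀ n t, ‖φ (Q n) t - 1‖ ≤ 1 + ‖φ (Q n) t‖ := fun n t => by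
    refine (norm_sub_le _ _).trans_eq ?_
    rw [norm_one, add_comm]
  have hcau : CauchySeq S := by
    refine cauchySeq_of_le_geometric r ((1 - r) * 3) hr1 fun n => ?_
    rw [hS, dist_self_add_right, norm_smul, hwn, mul_right_comm _ 3]
    refine mul_le_mul_of_nonneg_left ?_ (hw n)
    refine (ContinuousMap.norm_le _ (by norm_num)).2 fun t => (hφ1 n t).trans ?_
    linarith [hφ2 (Q n) t]
  obtain ⟨T, hT⟩ := cauchySeq_tendsto_of_complete hcau
  have hTt : ∀ t, Filter.Tendsto (fun n => S n t) Filter.atTop (nhds (T t)) := fun t =>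
    ((continuous_eval_const t).tendsto T).comp hT
  -- The weights used so far add up to `1 - r ^ n`, so `p n` is the weighted sum of the peak
  -- functions themselves.
  let p : ℕ → K → 𝕜 := fun n t => S n t + ((1 - r ^ n : ℝ) : 𝕜)
  have hpT : ∀ t, Filter.Tendsto (fun n => p n t) Filter.atTop (nhds (T t + 1)) := fun t => by
    have h1 : Filter.Tendsto (fun n : ℕ => ((1 - r ^ n : ℝ) : 𝕜)) Filter.atTop (nhds 1) := by
      have := (tendsto_pow_atTop_nhds_zero_of_lt_one hr0.le hr1).const_sub (1 : ℝ)
      rw [sub_zero] at this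
      have h2 := (RCLike.continuous_ofReal (K := 𝕜)).tendsto (1 : ℝ) |>.comp this
      rwa [RCLike.ofReal_one] at h2
    exact (hTt t).add h1
  have hps : ∀ n t, p (n + 1) t = p n t + (((1 - r) * r ^ n : ℝ) : 𝕜) * φ (Q n) t := fun n t => by
    simp only [p, hS, ContinuousMap.add_apply, ContinuousMap.smul_apply, ContinuousMap.sub_apply,
      ContinuousMap.one_apply, smul_eq_mul]
    push_cast
    ring
  have hpn : ∀ n t, ‖p (n + 1) t‖ ≤ ‖p n t‖ + (1 - r) * r ^ n * ‖φ (Q n) t‖ := fun n t => by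
    rw [hps]
    refine (norm_add_le _ _).trans_eq ?_
    rw [norm_mul, hwn]
  refine ⟨T + 1, A.add_mem (hA.mem_of_tendsto hT (.of_forall fun n => (Q n).2.1)) A.one_mem,
    fun t ht => ?_, fun t ht => ?_, fun t => ?_⟩
  · have h1 : ∀ n, S n t = 0 := fun n => (Q n).2.2.1 t ht
    have h2 := hTt t
    simp only [h1] at h2
    rw [ContinuousMap.add_apply, tendsto_nhds_unique h2 tendsto_const_nhds]
    simp
  · have h1 : ∀ n, ‖p n t‖ ≤ δ * (1 - r ^ n) := fun n => by
      induction n with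
      | zero => simp [p, S, Q]
      | succ n ih =>
        have h2 := mul_le_mul_of_nonneg_left (hφδ (Q n) t fun h => ht (hUV n h)) (hw n)
        rw [pow_succ]
        linarith [hpn n t]
    refine le_of_tendsto (hpT t).norm (.of_forall fun n => (h1 n).trans ?_)
    have := mul_nonneg hδ0.le (pow_nonneg hr0.le n)
    linarith
  · have h1 : ∀ n, ‖p n t‖ + (1 - ε) * ‖S n t‖ ≤ 1 := by
      refine norm_add_mul_norm_le_one_of_geometric (U := fun n => t ∈ U n)
        (x := fun n => ‖φ (Q n) t‖) (y := fun n => ‖φ (Q n) t - 1‖) hr0.le hr1.le hδ0.le hε1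
        (by linarith) (fun n => ?_) (fun n => hpn n t) (fun n => ?_)
        rfl (fun n => hφ2 _ t) (fun n => hφ1 n t) (fun n => hin n t) (fun n => hφδ (Q n) t)
      · rw [hS]
        refine (norm_add_le _ _).trans_eq ?_
        rw [ContinuousMap.smul_apply, norm_smul, hwn]
        rfl
      · refine (norm_add_le _ _).trans_eq ?_
        rw [RCLike.norm_ofReal, abs_of_nonneg (sub_nonneg.2 (pow_le_one₀ hr0.le hr1.le))]
    have h2 := (hpT t).norm.add ((hTt t).norm.const_mul (1 - ε))
    have h3 := le_of_tendsto h2 (.of_forall h1)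
    have h4 : 1 - (T + 1) t = - T t := by simp
    rw [h4, norm_neg]
    exact h3

/-! ### Sources of approximate peak sets. -/

/-- Points of the Choquet boundary are approximate peak sets. -/
theorem isApproxPeakSet_singleton_of_mem_choquetBoundary {𝕜 K : Type*} [RCLike 𝕜]
    [TopologicalSpace K] [CompactSpace K] [T2Space K] {A : Subalgebra 𝕜 C(K, 𝕜)}
    (hA : IsUniformAlgebra A) {t₀ : K} (ht₀ : t₀ ∈ choquetBoundary A) :
    IsApproxPeakSet A {t₀} := by
  intro U hU htU δ hδ
  obtain ⟨φ, hφ, h1, h2, h3⟩ :=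
    exists_approx_peak_of_mem_choquetBoundary hA ht₀ hU (Set.singleton_subset_iff.1 htU) hδ
  exact ⟨φ, hφ, fun t ht => by rw [Set.mem_singleton_iff.1 ht, h1], h2, h3⟩

/-- The set where a contraction equals `1` is an approximate peak set. -/
theorem isApproxPeakSet_setOf_eq_one {𝕜 K : Type*} [RCLike 𝕜] [TopologicalSpace K]
    [CompactSpace K] {A : Subalgebra 𝕜 C(K, 𝕜)} {f : C(K, 𝕜)} (hf : f ∈ A)
    (hf1 : ∀ t, ‖f t‖ ≤ 1) : IsApproxPeakSet A {t | f t = 1} := by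
  intro U hU hPU δ hδ
  -- Averaging with 1 gives modulus 1 only where `f = 1`; by compactness high powers are then
  -- uniformly small off `U`.
  let g : C(K, 𝕜) := (2⁻¹ : 𝕜) • (1 + f)
  have hgA : g ∈ A := A.smul_mem (A.add_mem A.one_mem hf) _
  have hg : ∀ t, ‖g t‖ = 2⁻¹ * ‖1 + f t‖ := fun t => by
    rw [ContinuousMap.smul_apply, norm_smul, norm_inv, RCLike.norm_ofNat]
    rfl
  have hg1 : ∀ t, ‖g t‖ ≤ 1 := fun t => by
    have h1 := norm_add_le (1 : 𝕜) (f t)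
    rw [norm_one] at h1
    rw [hg]
    linarith [hf1 t]
  have hlt : ∀ t ∉ U, ‖g t‖ < 1 := by
    refine fun t ht => (hg1 t).lt_of_ne fun h => ht (hPU ?_)
    have h1 : ‖1 + f t‖ = 2 := by rw [hg] at h; linarith
    have h2 : ‖(1 : 𝕜) + f t‖ ^ 2 = 1 + 2 * RCLike.re (f t) + ‖f t‖ ^ 2 := by
      rw [← RCLike.normSq_eq_def', ← RCLike.normSq_eq_def', RCLike.normSq_add]
      simp
      ring
    have h3 : 1 ≤ RCLike.re (f t) := by
      rw [h1] at h2
      nlinarith [hf1 t, norm_nonneg (f t)]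
    have h4 : ‖f t‖ = 1 := le_antisymm (hf1 t) (h3.trans (RCLike.re_le_norm _))
    have h5 := RCLike.norm_le_re_iff_eq_norm.1 ((hf1 t).trans h3)
    rw [Set.mem_ofPred_eq, h5, h4, RCLike.ofReal_one]
  obtain ⟨c, hc1, hc⟩ : ∃ c : ℝ, c < 1 ∧ ∀ t ∉ U, ‖g t‖ ≤ c := by
    rcases (Uᶜ).eq_empty_or_nonempty with h | h
    · exact ⟨0, one_pos, fun t ht => (h ▸ ht : t ∈ (∅ : Set K)).elim⟩
    · obtain ⟨t, ht, hmax⟩ := hU.isClosed_compl.isCompact.exists_isMaxOn h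
        g.continuous.norm.continuousOn
      exact ⟨‖g t‖, hlt t ht, fun s hs => hmax hs⟩
  obtain ⟨n, hn⟩ := exists_pow_lt_of_lt_one hδ hc1
  refine ⟨g ^ n, A.pow_mem hgA n, fun t ht => ?_, fun t => ?_, fun t ht => ?_⟩
  · have h1 : g t = 1 := by
      have h2 : f t = 1 := ht
      simp only [g, ContinuousMap.smul_apply, ContinuousMap.add_apply, ContinuousMap.one_apply,
        h2, smul_eq_mul]
      norm_num
    rw [ContinuousMap.pow_apply, h1, one_pow]
  · rw [ContinuousMap.pow_apply, norm_pow]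
    exact (pow_le_one₀ (norm_nonneg _) (hg1 t)).trans one_le_two
  · rw [ContinuousMap.pow_apply, norm_pow]
    exact (pow_le_pow_left₀ (norm_nonneg _) (hc t ht) n).trans hn.le

/-- An open set meeting the Shilov boundary contains a nonempty approximate peak set. -/
theorem exists_isApproxPeakSet_of_inter_shilovBoundary_nonempty {𝕜 K : Type*} [RCLike 𝕜]
    [TopologicalSpace K] [CompactSpace K] {A : Subalgebra 𝕜 C(K, 𝕜)} {V : Set K}
    (hV : IsOpen V) (h : (V ∩ shilovBoundary A).Nonempty) :
    ∃ P ⊆ V, P.Nonempty ∧ IsApproxPeakSet A P := by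
  obtain ⟨s, hsV, hs⟩ := h
  have hnb : ¬ IsAlgBoundary A Vᶜ := fun hb => hs Vᶜ ⟨hV.isClosed_compl, hb⟩ hsV
  simp only [IsAlgBoundary, not_forall, not_exists, not_and] at hnb
  obtain ⟨f, hf, hfV⟩ := hnb
  obtain ⟨t₁, -, hmax⟩ := isCompact_univ.exists_isMaxOn ⟨s, Set.mem_univ s⟩
    f.continuous.norm.continuousOn
  have hle : ∀ t, ‖f t‖ ≤ ‖f t₁‖ := fun t => hmax (Set.mem_univ t)
  have ht₁ : ‖f t₁‖ = ‖f‖ :=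
    le_antisymm (f.norm_coe_le_norm t₁) ((f.norm_le (norm_nonneg _)).2 hle)
  have hlt : ∀ t ∉ V, ‖f t‖ < ‖f t₁‖ := fun t ht =>
    (hle t).lt_of_ne fun h => hfV t ht (h.trans ht₁)
  have ht₁V : t₁ ∈ V := by
    by_contra h
    exact (hlt t₁ h).false
  -- If the maximum is zero, no point can lie outside `V`, so `V` is all of `K` and the constant 1
  -- serves.
  by_cases h0 : f t₁ = 0
  · refine ⟨{t | (1 : C(K, 𝕜)) t = 1}, fun t _ => ?_, ⟨t₁, rfl⟩,
      isApproxPeakSet_setOf_eq_one A.one_mem fun t => by simp⟩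
    by_contra h
    have := hlt t h
    rw [h0, norm_zero] at this
    exact (norm_nonneg _).not_gt this
  · have hn : 0 < ‖f t₁‖ := norm_pos_iff.2 h0
    refine ⟨{t | ((f t₁)⁻¹ • f) t = 1}, fun t ht => ?_, ⟨t₁, by simp [h0]⟩,
      isApproxPeakSet_setOf_eq_one (A.smul_mem hf _) fun t => ?_⟩
    · by_contra h
      have h1 : (f t₁)⁻¹ * f t = 1 := ht
      rw [inv_mul_eq_one₀ h0] at h1
      exact (hlt t h).ne (by rw [h1])
    · rw [ContinuousMap.smul_apply, norm_smul, norm_inv, inv_mul_le_iff₀ hn, mul_one]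
      exact hle t

/-! ### Interpolation and `Δ`-points in the function space. -/

section FunctionSpace

variable {𝕜 K X : Type*} [RCLike 𝕜] [TopologicalSpace K] [CompactSpace K]
  [NormedAddCommGroup X] [NormedSpace 𝕜 X] {A : Subalgebra 𝕜 C(K, 𝕜)} {M : Submodule 𝕜 C(K, X)}

/-- Interpolation between an element of a function space and a vector along a function with
values in a Stolz region. -/
theorem IsFunctionSpaceOver.exists_interpolation (hM : IsFunctionSpaceOver M A) (f : M)
    (hf : ‖f‖ ≤ 1) {x : X} (hx : ‖x‖ ≤ 1) {Φ : C(K, 𝕜)} (hΦ : Φ ∈ A) {ε : ℝ} (hε : ε ≤ 1)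
    (hst : ∀ t, ‖Φ t‖ + (1 - ε) * ‖1 - Φ t‖ ≤ 1) :
    ∃ y : M, ‖y‖ ≤ 1 ∧
      ∀ t, y.1 t = (((1 - ε : ℝ) : 𝕜) * (1 - Φ t)) • f.1 t + Φ t • x := by
  refine ⟨⟨(((1 - ε : ℝ) : 𝕜) • (1 - Φ)) • f.1 + Φ • ContinuousMap.const K x,
    M.add_mem (hM.smul_mem _ (A.smul_mem (A.sub_mem A.one_mem hΦ) _) _ f.2)
      (hM.tensor_mem Φ hΦ x)⟩, ?_, fun t => rfl⟩
  refine (ContinuousMap.norm_le _ zero_le_one).2 fun t => ?_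
  change ‖(((1 - ε : ℝ) : 𝕜) * (1 - Φ t)) • f.1 t + Φ t • x‖ ≤ 1
  refine (norm_add_le _ _).trans ?_
  rw [norm_smul, norm_smul, norm_mul, RCLike.norm_ofReal, abs_of_nonneg (sub_nonneg.2 hε)]
  have h1 : ‖f.1 t‖ ≤ 1 := (f.1.norm_coe_le_norm t).trans hf
  have h2 := mul_le_of_le_one_right
    (mul_nonneg (sub_nonneg.2 hε) (norm_nonneg (1 - Φ t))) h1
  have h3 := mul_le_of_le_one_right (norm_nonneg (Φ t)) hx
  linarith [hst t]

/-- An open set meeting the Shilov boundary, on which `f` is almost of norm one, allows to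
reflect `f` inside this set. -/
theorem IsFunctionSpaceOver.exists_mem_deltaSet (hM : IsFunctionSpaceOver M A) (f : M)
    (hf : ‖f‖ ≤ 1) {V : Set K} (hV : IsOpen V) (hVΓ : (V ∩ shilovBoundary A).Nonempty) {η : ℝ}
    (hfV : ∀ t ∈ V, 1 - η / 2 ≤ ‖f.1 t‖) {ε : ℝ} (hε : 0 < ε) (hε1 : ε ≤ 1) :
    ∃ y ∈ deltaSet f η, ∀ t ∉ V, ‖f.1 t - y.1 t‖ ≤ 3 * ε := by
  obtain ⟨P, hPV, ⟨s, hs⟩, hP⟩ := exists_isApproxPeakSet_of_inter_shilovBoundary_nonempty hV hVΓ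
  obtain ⟨Φ, hΦ, h1, h2, h3⟩ := hP.exists_stolz hM.isUniformAlgebra.isClosed hV hPV hε hε1
  have hft : ∀ t, ‖f.1 t‖ ≤ 1 := fun t => (f.1.norm_coe_le_norm t).trans hf
  -- Interpolating towards `-f(s)` with `Φ s = 1` gives `(f - y)(s) = 2 f(s)`.
  obtain ⟨y, hy1, hy⟩ := hM.exists_interpolation f hf (x := -f.1 s)
    (by rw [norm_neg]; exact hft s) hΦ hε1 h3
  refine ⟨y, ⟨hy1, ?_⟩, fun t ht => ?_⟩
  · refine le_trans ?_ ((f - y).1.norm_coe_le_norm s)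
    have h4 : (f - y).1 s = (2 : 𝕜) • f.1 s := by
      change f.1 s - y.1 s = _
      rw [hy, h1 s hs, two_smul]
      simp
    rw [h4, norm_smul, RCLike.norm_ofNat]
    linarith [hfV s (hPV hs)]
  · have h4 : f.1 t - y.1 t =
        ((ε : 𝕜) + ((1 - ε : ℝ) : 𝕜) * Φ t) • f.1 t + Φ t • f.1 s := by
      rw [hy]
      push_cast
      module
    have h5 : ‖(ε : 𝕜) + ((1 - ε : ℝ) : 𝕜) * Φ t‖ ≤ 2 * ε := by
      refine (norm_add_le _ _).trans ?_
      rw [norm_mul, RCLike.norm_ofReal, RCLike.norm_ofReal, abs_of_pos hε,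
        abs_of_nonneg (sub_nonneg.2 hε1)]
      have := mul_le_of_le_one_left (norm_nonneg (Φ t)) (show 1 - ε ≤ 1 by linarith)
      linarith [h2 t ht]
    rw [h4]
    refine (norm_add_le _ _).trans ?_
    rw [norm_smul, norm_smul]
    have h6 := mul_le_of_le_one_right (norm_nonneg ((ε : 𝕜) + ((1 - ε : ℝ) : 𝕜) * Φ t)) (hft t)
    have h7 := mul_le_of_le_one_right (norm_nonneg (Φ t)) (hft s)
    linarith [h2 t ht]

variable [NormedSpace ℝ X] [IsScalarTower ℝ 𝕜 X]

/-- Evaluation at a point, as a real-linear map on a function space. -/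
def evalRealLinear (M : Submodule 𝕜 C(K, X)) (t : K) : M →ₗ[ℝ] X where
  toFun f := f.1 t
  map_add' _ _ := rfl
  map_smul' _ _ := rfl

theorem norm_le_of_forall_norm_evalRealLinear_le {f : M} {C : ℝ} (hC : 0 ≤ C)
    (h : ∀ t, ‖evalRealLinear M t f‖ ≤ C) : ‖f‖ ≤ C :=
  (ContinuousMap.norm_le f.1 hC).2 h

/-- A norm-one function whose norm is attained at a limit point of the Shilov boundary is a
`Δ`-point. -/
theorem IsFunctionSpaceOver.isDeltaPoint [T2Space K] (hM : IsFunctionSpaceOver M A) {f : M}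
    (hf : ‖f‖ = 1) {t₀ : K} (ht₀ : t₀ ∈ derivedSet (shilovBoundary A)) (hft₀ : ‖f.1 t₀‖ = 1) :
    IsDeltaPoint f := by
  refine ⟨hf, fun η hη => Metric.mem_closure_iff.2 fun δ hδ => ?_⟩
  let W : Set K := {t | 1 - η / 2 < ‖f.1 t‖}
  have hW : IsOpen W := isOpen_lt continuous_const f.1.continuous.norm
  have ht₀W : t₀ ∈ W := by
    change 1 - η / 2 < ‖f.1 t₀‖
    rw [hft₀]; linarith
  have hinf : (W ∩ shilovBoundary A).Infinite :=
    Set.Infinite.of_accPt (AccPt.nhds_inter ht₀ (hW.mem_nhds ht₀W))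
  -- Each point lies in at most one of the `n` disjoint sets, where the error is at most 2;
  -- elsewhere it is at most `δ / 2`. The average error is thus at most `δ / 2 + 2 / n < δ`.
  obtain ⟨n, hn⟩ := exists_nat_gt (4 / δ)
  have hn0 : (0 : ℝ) < n := (div_pos four_pos hδ).trans hn
  obtain ⟨s, hsW, hsn⟩ := hinf.exists_subset_card_eq n
  obtain ⟨U, hU, hUd⟩ := s.finite_toSet.t2_separation
  have hε : 0 < min 1 (δ / 6) := lt_min one_pos (by positivity)
  have hex : ∀ x ∈ s, ∃ y : M, y ∈ deltaSet f η ∧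
      ∀ t ∉ U x ∩ W, ‖f.1 t - y.1 t‖ ≤ 3 * min 1 (δ / 6) := fun x hx =>
    hM.exists_mem_deltaSet f hf.le ((hU x).2.inter hW)
      ⟨x, ⟨(hU x).1, (hsW hx).1⟩, (hsW hx).2⟩ (fun t ht => ht.2.le) hε (min_le_left _ _)
  choose! y hyd hyU using hex
  have hsum : ∑ x ∈ s, (n : ℝ)⁻¹ = 1 := by
    rw [Finset.sum_const, hsn, nsmul_eq_mul, mul_inv_cancel₀ hn0.ne']
  refine ⟨∑ x ∈ s, (n : ℝ)⁻¹ • y x, (convex_convexHull ℝ _).sum_mem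
    (fun _ _ => inv_nonneg.2 hn0.le) hsum fun x hx => subset_convexHull ℝ _ (hyd x hx), ?_⟩
  have hdiff : f - ∑ x ∈ s, (n : ℝ)⁻¹ • y x = (n : ℝ)⁻¹ • ∑ x ∈ s, (f - y x) := by
    rw [Finset.smul_sum]
    simp only [smul_sub]
    rw [Finset.sum_sub_distrib, ← Finset.sum_smul, hsum, one_smul]
  have hbound : ‖∑ x ∈ s, (f - y x)‖ ≤ n * (δ / 2) + 2 := by
    refine norm_le_of_forall_norm_evalRealLinear_le (by positivity) fun t => ?_
    classical
    rw [map_sum]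
    calc _ ≤ ∑ x ∈ s, ‖evalRealLinear M t (f - y x)‖ := norm_sum_le _ _
      _ ≤ ∑ x ∈ s, (δ / 2 + if t ∈ U x then 2 else 0) := by
        refine Finset.sum_le_sum fun x hx => ?_
        change ‖f.1 t - (y x).1 t‖ ≤ _
        split_ifs with h
        · have h1 := (norm_sub_le (f.1 t) ((y x).1 t))
          have h2 : ‖f.1 t‖ ≤ 1 := (f.1.norm_coe_le_norm t).trans hf.le
          have h3 : ‖(y x).1 t‖ ≤ 1 := ((y x).1.norm_coe_le_norm t).trans (hyd x hx).1
          linarith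
        · have h1 := hyU x hx t fun h' => h h'.1
          linarith [min_le_right (1 : ℝ) (δ / 6)]
      _ = n * (δ / 2) + (s.filter fun x => t ∈ U x).card * 2 := by
        rw [Finset.sum_add_distrib, Finset.sum_const, hsn, nsmul_eq_mul, ← Finset.sum_filter,
          Finset.sum_const, nsmul_eq_mul]
      _ ≤ n * (δ / 2) + 2 := by
        have h1 : (s.filter fun x => t ∈ U x).card ≤ 1 := by
          refine Finset.card_le_one.2 fun a ha b hb => ?_
          rw [Finset.mem_filter] at ha hb
          exact hUd.elim ha.1 hb.1 (Set.not_disjoint_iff.2 ⟨t, ha.2, hb.2⟩)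
        have h2 : ((s.filter fun x => t ∈ U x).card : ℝ) ≤ 1 := by exact_mod_cast h1
        linarith
  rw [dist_eq_norm, hdiff, norm_smul, norm_inv, Real.norm_of_nonneg hn0.le]
  rw [div_lt_iff₀ hδ] at hn
  rw [inv_mul_lt_iff₀ hn0]
  linarith

end FunctionSpace

/-! ### Approximation of the unit ball by combinations of `Δ`-points. -/

theorem mainTheorem9 {𝕜 K X : Type*} [RCLike 𝕜]
    [TopologicalSpace K] [CompactSpace K] [T2Space K]
    [NormedAddCommGroup X] [NormedSpace 𝕜 X] [NormedSpace ℝ X] [IsScalarTower ℝ 𝕜 X]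
    [CompleteSpace X] [UniformConvexSpace X]
    (A : Subalgebra 𝕜 C(K, 𝕜)) (M : Submodule 𝕜 C(K, X))
    (hM : IsFunctionSpaceOver M A)
    (h : (derivedSet (shilovBoundary A) ∩ choquetBoundary A).Nonempty) :
    ConvexDLD2P M := by
  obtain ⟨t₀, hΓ, hCh⟩ := h
  have hA := hM.isUniformAlgebra
  refine subset_antisymm (closure_minimal (convexHull_min (fun f hf => ?_)
    (convex_closedBall 0 1)) Metric.isClosed_closedBall) fun f hf => ?_
  · rw [mem_closedBall_zero_iff]
    exact hf.1.le
  rw [mem_closedBall_zero_iff] at hf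
  have hft : ∀ t, ‖f.1 t‖ ≤ 1 := fun t => (f.1.norm_coe_le_norm t).trans hf
  have hX : ∃ x : X, x ≠ 0 := by
    have h1 : (1 : C(K, 𝕜)) ∈ (A : Set C(K, 𝕜)) := A.one_mem
    rw [hM.coe_base] at h1
    obtain ⟨φ, g, -, hg⟩ := h1
    refine ⟨g t₀, fun h0 => ?_⟩
    have := hg t₀
    rw [h0, map_zero] at this
    exact one_ne_zero this
  obtain ⟨v, a, ha0, ha1, hv, hav⟩ :
      ∃ (v : X) (a : ℝ), 0 ≤ a ∧ a ≤ 1 ∧ ‖v‖ = 1 ∧ a • v = f.1 t₀ := by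
    by_cases h0 : f.1 t₀ = 0
    · obtain ⟨x, hx⟩ := hX
      refine ⟨‖x‖⁻¹ • x, 0, le_rfl, zero_le_one, ?_, by rw [zero_smul, h0]⟩
      rw [norm_smul, norm_inv, norm_norm, inv_mul_cancel₀ (norm_ne_zero_iff.2 hx)]
    · refine ⟨‖f.1 t₀‖⁻¹ • f.1 t₀, ‖f.1 t₀‖, norm_nonneg _, hft t₀, ?_, ?_⟩
      · rw [norm_smul, norm_inv, norm_norm, inv_mul_cancel₀ (norm_ne_zero_iff.2 h0)]
      · rw [smul_inv_smul₀ (norm_ne_zero_iff.2 h0)]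
  refine Metric.mem_closure_iff.2 fun η hη => ?_
  let W : Set K := {t | ‖f.1 t - f.1 t₀‖ < η / 4}
  have hW : IsOpen W :=
    isOpen_lt (f.1.continuous.sub continuous_const).norm continuous_const
  have ht₀W : t₀ ∈ W := by
    change ‖f.1 t₀ - f.1 t₀‖ < η / 4
    rw [sub_self, norm_zero]; positivity
  obtain ⟨ε, hε, hε1, hεη⟩ : ∃ ε : ℝ, 0 < ε ∧ ε ≤ 1 ∧ ε ≤ η / 8 :=
    ⟨min 1 (η / 8), lt_min one_pos (by positivity), min_le_left _ _, min_le_right _ _⟩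
  obtain ⟨Φ, hΦ, h1, h2, h3⟩ :=
    (isApproxPeakSet_singleton_of_mem_choquetBoundary hA hCh).exists_stolz hA.isClosed hW
      (Set.singleton_subset_iff.2 ht₀W) hε hε1
  have hΦt₀ : Φ t₀ = 1 := h1 t₀ rfl
  have hΔ : ∀ x : X, ‖x‖ = 1 → ∃ y : M, IsDeltaPoint y ∧
      ∀ t, y.1 t = (((1 - ε : ℝ) : 𝕜) * (1 - Φ t)) • f.1 t + Φ t • x := by
    intro x hx
    obtain ⟨y, hy1, hy⟩ := hM.exists_interpolation f hf hx.le hΦ hε1 h3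
    have hyt₀ : ‖y.1 t₀‖ = 1 := by
      rw [hy, hΦt₀, sub_self, mul_zero, zero_smul, zero_add, one_smul, hx]
    exact ⟨y, hM.isDeltaPoint (le_antisymm hy1 (hyt₀ ▸ y.1.norm_coe_le_norm t₀)) hΓ hyt₀, hy⟩
  obtain ⟨y, hyΔ, hy⟩ := hΔ v hv
  obtain ⟨z, hzΔ, hz⟩ := hΔ (-v) (by rw [norm_neg, hv])
  refine ⟨((1 + a) / 2) • y + ((1 - a) / 2) • z, convex_convexHull ℝ _
    (subset_convexHull ℝ {x : M | IsDeltaPoint x} hyΔ)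
    (subset_convexHull ℝ {x : M | IsDeltaPoint x} hzΔ) (by linarith)
    (by linarith) (by ring), ?_⟩
  rw [dist_eq_norm]
  refine (norm_le_of_forall_norm_evalRealLinear_le (C := 3 * η / 4) (by positivity)
    fun t => ?_).trans_lt (by linarith)
  have hΦ1 : ‖Φ t‖ ≤ 1 := by
    have := mul_nonneg (sub_nonneg.2 hε1) (norm_nonneg (1 - Φ t))
    linarith [h3 t]
  -- The weights `(1 ± a)/2` turn `v` and `-v` into `a v = f(t₀)`. The remaining error is small
  -- because `ε` is small, and either `f` is near `f(t₀)` (in `W`) or `Φ` is small (off `W`).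
  have hval : evalRealLinear M t (f - (((1 + a) / 2) • y + ((1 - a) / 2) • z)) =
      ((ε : 𝕜) * (1 - Φ t)) • f.1 t + Φ t • (f.1 t - f.1 t₀) := by
    change f.1 t - (((1 + a) / 2) • y.1 t + ((1 - a) / 2) • z.1 t) = _
    rw [hy, hz, ← hav, ← algebraMap_smul 𝕜 ((1 + a) / 2), ← algebraMap_smul 𝕜 ((1 - a) / 2),
      ← algebraMap_smul 𝕜 a]
    simp only [RCLike.algebraMap_eq_ofReal]
    push_cast
    module
  rw [hval]
  refine (norm_add_le _ _).trans ?_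
  rw [norm_smul, norm_smul, norm_mul, RCLike.norm_ofReal, abs_of_pos hε]
  have h4 : ‖1 - Φ t‖ ≤ 2 := by
    refine (norm_sub_le _ _).trans ?_
    rw [norm_one]; linarith
  have h5 : ε * ‖1 - Φ t‖ * ‖f.1 t‖ ≤ ε * 2 :=
    (mul_le_of_le_one_right (by positivity) (hft t)).trans (mul_le_mul_of_nonneg_left h4 hε.le)
  have h6 : ‖Φ t‖ * ‖f.1 t - f.1 t₀‖ ≤ η / 4 := by
    by_cases ht : t ∈ W
    · exact (mul_le_of_le_one_left (norm_nonneg _) hΦ1).trans ht.le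
    · have h7 : ‖f.1 t - f.1 t₀‖ ≤ 2 :=
        (norm_sub_le _ _).trans (by linarith [hft t, hft t₀])
      have h8 := mul_le_mul (h2 t ht) h7 (norm_nonneg _) hε.le
      linarith
  linarith
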